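/- An \emph{MV-algebra} is an algebra $(N;\oplus,{}',0,1)$ such that $(N;\oplus,0)$ is a commutative monoid, $x''=x$, $0'=1$, $x\oplus 1=1$ and $x\oplus(x\oplus y')'=y\oplus(y\oplus x')'$; it is ordered by $x\le y\iff x'\oplus y=1$. An \emph{ideal} of $N$ is a non-empty down-set closed under $\oplus$; it is \emph{maximal} if it is different from $N$ and not strictly contained in another ideal different from $N$. An element $a$ is \emph{idempotent} if $a\oplus a=a$. An ideal $I$ \emph{has enough idempotents} if every $x\in I$ satisfies $x\le a$ for some idempotent $a\in I$. Put $I'=\{x'\mid x\in I\}$. An \emph{EMV-algebra} is an algebra $(M;\vee,\wedge,\oplus,0)$ such that $(M;\vee,\wedge,0)$ is a distributive lattice with least element $0$; $(M;\oplus,0)$ is a commutative monoid in which $\oplus$ is order-preserving; for all idempotents $a\le b$ and all $x\in[a,b]$ the element $\lambda_{a,b}(x)=\min\{z\in[a,b]\mid x\oplus z=b\}$ exists, and $([a,b];\oplus,\lambda_{a,b},a,b)$ is an MV-algebra; and every $x\in M$ lies below an idempotent. It is \emph{proper} if it has no greatest element. An \emph{EMV-homomorphism} is a map $f$ preserving $\vee,\wedge,\oplus,0$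 with $f(\lambda_{0,b}(x))=\lambda_{0,f(b)}(f(x))$ for all idempotents $b$ and all $x\le b$. Let $\mathcal{PEMV}$ be the category of proper EMV-algebras and EMV-homomorphisms. Let $\mathcal{PMV}$ be the category whose objects are the pairs $(N,I)$, where $N$ is an MV-algebra and $I$ is a maximal ideal of $N$ that has enough idempotents and no greatest element, with $N=I\cup I'$, and whose morphisms $(N_1,I_1)\to(N_2,I_2)$ are the MV-homomorphisms $\phi:N_1\to N_2$ with $\phi(I_1)\subseteq I_2$. For $(N,I)$ in $\mathcal{PMV}$, the ideal $I$ with the operations inherited from $N$ is a proper EMV-algebra; let $\Phi:\mathcal{PMV}\to\mathcal{PEMV}$ be the functor $\Phi(N,I)=I$, $\Phi(\phi)=\phi|_{I_1}$. \textbf{Theorem.} The functor $\Phi$ is an equivalence of the categories $\mathcal{PMV}$ and $\mathcal{PEMV}$. In addition, if $h:\Phi(N,I)\to\Phi(N',I')$ is a morphism of proper EMV-algebras (where $(N,I)$ and $(N',I')$ are objects of $\mathcal{PMV}$), then there is a unique morphism $\phi:(N,I)\to(N',I')$ of $\mathcal{PMV}$ with $h=\Phi(\phi)$, and (i) if $h$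 is surjective, so is $\phi$; (ii) if $h$ is injective, so is $\phi$. -/

import Mathlib

open CategoryTheory

universe u

/-! ### MV-algebras -/

/-- An MV-algebra `(N; ⊕, ', 0, 1)`; here `⊕` is written `+` and `x'` is written `xᶜ`.
The law `0ᶜ = 1` is part of the standard definition (there `1` is an abbreviation of `0'`). -/
class MVAlgebra (N : Type u) extends AddCommMonoid N, One N, Compl N where
  compl_compl' : ∀ x : N, xᶜᶜ = x
  compl_zero' : (0 : N)ᶜ = 1
  add_one' : ∀ x : N, x + 1 = 1
  luk' : ∀ x y : N, x + (x + yᶜ)ᶜ = y + (y + xᶜ)ᶜ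

/-- `(S; add, neg, zero, one)` is an MV-algebra, where `S` is a subset of `M`. -/
structure IsMVAlgebraOn {M : Type u} (S : Set M) (add : M → M → M) (neg : M → M)
    (zero one : M) : Prop where
  zero_mem : zero ∈ S
  one_mem : one ∈ S
  add_mem : ∀ x ∈ S, ∀ y ∈ S, add x y ∈ S
  neg_mem : ∀ x ∈ S, neg x ∈ S
  add_assoc : ∀ x ∈ S, ∀ y ∈ S, ∀ z ∈ S, add (add x y) z = add x (add y z)
  add_comm : ∀ x ∈ S, ∀ y ∈ S, add x y = add y x
  add_zero : ∀ x ∈ S, add x zero = x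
  neg_neg : ∀ x ∈ S, neg (neg x) = x
  neg_zero : neg zero = one
  add_one : ∀ x ∈ S, add x one = one
  luk : ∀ x ∈ S, ∀ y ∈ S, add x (neg (add x (neg y))) = add y (neg (add y (neg x)))

/-- Homomorphisms of MV-algebras. -/
@[ext]
structure MVHom (N₁ N₂ : Type u) [MVAlgebra N₁] [MVAlgebra N₂] where
  toFun : N₁ → N₂
  map_add : ∀ x y, toFun (x + y) = toFun x + toFun y
  map_compl : ∀ x, toFun xᶜ = (toFun x)ᶜ
  map_zero : toFun 0 = 0
  map_one : toFun 1 = 1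

namespace MVAlgebra

variable {N : Type u} [MVAlgebra N]

theorem compl_one' : (1 : N)ᶜ = 0 := by
  rw [← compl_zero', compl_compl']

theorem add_compl' (x : N) : x + xᶜ = 1 := by
  have h := luk' x (1 : N)
  rw [compl_one', add_zero, add_comm (1 : N) (_)ᶜ, add_one'] at h
  exact h

theorem exists_add_of_le {x y : N} (h : xᶜ + y = 1) : ∃ d, y = x + d := by
  refine ⟨(x + yᶜ)ᶜ, ?_⟩
  rw [luk', add_comm y xᶜ, h, compl_one', add_zero]

theorem le_add_aux (x d : N) : xᶜ + (x + d) = 1 := by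
  rw [← add_assoc, add_comm xᶜ x, add_compl', add_comm, add_one']

/-- The natural order of an MV-algebra: `x ≤ y` iff `x' ⊕ y = 1`. -/
instance instPartialOrder : PartialOrder N where
  le x y := xᶜ + y = 1
  le_refl x := by
    show xᶜ + x = 1
    rw [add_comm, add_compl']
  le_trans x y z hxy hyz := by
    obtain ⟨d, rfl⟩ := exists_add_of_le hxy
    obtain ⟨e, rfl⟩ := exists_add_of_le hyz
    show xᶜ + (x + d + e) = 1
    rw [add_assoc, le_add_aux]
  le_antisymm x y hxy hyx := by
    have h := luk' x y
    have hxy' : xᶜ + y = 1 := hxy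
    have hyx' : yᶜ + x = 1 := hyx
    rw [add_comm x yᶜ, hyx', add_comm y xᶜ, hxy', compl_one', add_zero, add_zero] at h
    exact h

theorem le_def (x y : N) : x ≤ y ↔ xᶜ + y = 1 := Iff.rfl

theorem le_self_add (x d : N) : x ≤ x + d := le_add_aux x d

theorem add_mono {x y z w : N} (h : x ≤ y) (h' : z ≤ w) : x + z ≤ y + w := by
  obtain ⟨d, rfl⟩ := exists_add_of_le h
  obtain ⟨e, rfl⟩ := exists_add_of_le h'
  rw [add_add_add_comm]
  exact le_self_add _ _

theorem compl_anti {x y : N} (h : x ≤ y) : yᶜ ≤ xᶜ := by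
  rw [le_def] at h ⊢
  rw [compl_compl', add_comm, h]

theorem compl_le_comm {x y : N} (h : xᶜ ≤ y) : yᶜ ≤ x := by
  have := compl_anti h
  rwa [compl_compl'] at this

/-- `x ∨ y = x ⊕ (x ⊕ y')' = (y ⊖ x) ⊕ x`. -/
def sup (x y : N) : N := x + (x + yᶜ)ᶜ

theorem sup_comm' (x y : N) : sup x y = sup y x := luk' x y

theorem le_sup_left' (x y : N) : x ≤ sup x y := le_self_add _ _

theorem sup_eq_of_le {x y : N} (h : x ≤ y) : sup x y = y := by
  rw [sup_comm', sup, add_comm y xᶜ, (le_def x y).1 h, compl_one', add_zero]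

theorem sup_le' {x y z : N} (hx : x ≤ z) (hy : y ≤ z) : sup x y ≤ z := by
  rw [← sup_eq_of_le hx]
  exact add_mono le_rfl (compl_anti (add_mono le_rfl (compl_anti hy)))

/-- `x ∧ y = (x' ∨ y')' = x ⊙ (x' ⊕ y)`. -/
def inf (x y : N) : N := (sup xᶜ yᶜ)ᶜ

/-- The lattice of an MV-algebra. -/
instance instLattice : Lattice N where
  sup := sup
  inf := inf
  le_sup_left := le_sup_left'
  le_sup_right x y := by
    show y ≤ sup x y
    rw [sup_comm']
    exact le_sup_left' y x
  sup_le _ _ _ := sup_le'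
  inf_le_left x y := compl_le_comm (le_sup_left' _ _)
  inf_le_right x y := by
    refine compl_le_comm ?_
    rw [sup_comm']
    exact le_sup_left' _ _
  le_inf x y z hy hz := by
    have h := compl_anti (sup_le' (compl_anti hy) (compl_anti hz))
    rwa [compl_compl'] at h

theorem sup_def (x y : N) : x ⊔ y = x + (x + yᶜ)ᶜ := rfl

theorem compl_sup' (x y : N) : (x ⊔ y)ᶜ = xᶜ ⊓ yᶜ := by
  show (sup x y)ᶜ = (sup xᶜᶜ yᶜᶜ)ᶜ
  rw [compl_compl', compl_compl']

theorem compl_inf' (x y : N) : (x ⊓ y)ᶜ = xᶜ ⊔ yᶜ := by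
  show (sup xᶜ yᶜ)ᶜᶜ = sup xᶜ yᶜ
  rw [compl_compl']

theorem zero_le' (x : N) : 0 ≤ x := by
  rw [le_def, compl_zero', add_comm, add_one']

theorem le_one' (x : N) : x ≤ 1 := by
  rw [le_def, add_one']

/-- Residuation: `x ⊙ y ≤ z` iff `y ≤ x' ⊕ z`, with `x ⊙ y = (x' ⊕ y')'`. -/
theorem odot_le_iff (x y z : N) : (xᶜ + yᶜ)ᶜ ≤ z ↔ y ≤ xᶜ + z := by
  rw [le_def, le_def, compl_compl']
  constructor <;> intro h <;> rw [← h] <;> abel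

theorem inf_def (x y : N) : x ⊓ y = (xᶜ + (xᶜ + y)ᶜ)ᶜ := by
  show (xᶜ + (xᶜ + yᶜᶜ)ᶜ)ᶜ = _
  rw [compl_compl']

theorem odot_sup_le (w y z : N) :
    ((y ⊔ z)ᶜ + wᶜ)ᶜ ≤ (yᶜ + wᶜ)ᶜ ⊔ (zᶜ + wᶜ)ᶜ := by
  rw [add_comm, odot_le_iff]
  refine sup_le ?_ ?_
  · rw [← odot_le_iff, add_comm]; exact le_sup_left
  · rw [← odot_le_iff, add_comm]; exact le_sup_right

/-- The lattice of an MV-algebra is distributive. -/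
instance instDistribLattice : DistribLattice N :=
  DistribLattice.ofInfSupLe (fun x y z => by
    have key : ∀ t : N, t ≤ y ⊔ z → (tᶜ + ((y ⊔ z)ᶜ + x)ᶜ)ᶜ ≤ x ⊓ t := fun t ht => by
      rw [inf_comm, inf_def]
      exact compl_anti (add_mono le_rfl (compl_anti (add_mono (compl_anti ht) le_rfl)))
    rw [inf_comm, inf_def]
    exact (odot_sup_le _ y z).trans
      (sup_le_sup (key y le_sup_left) (key z le_sup_right)))

theorem add_inf' (x y z : N) : x + (y ⊓ z) = (x + y) ⊓ (x + z) := by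
  refine le_antisymm (le_inf (add_mono le_rfl inf_le_left) (add_mono le_rfl inf_le_right)) ?_
  have h := (odot_le_iff xᶜ ((x + y) ⊓ (x + z)) (y ⊓ z)).1
  rw [compl_compl'] at h
  refine h (le_inf ?_ ?_)
  · have h' := (odot_le_iff xᶜ ((x + y) ⊓ (x + z)) y).2
    rw [compl_compl'] at h'
    exact h' inf_le_left
  · have h' := (odot_le_iff xᶜ ((x + y) ⊓ (x + z)) z).2
    rw [compl_compl'] at h'
    exact h' inf_le_right

theorem sup_le_add (x y : N) : x ⊔ y ≤ x + y :=
  sup_le (le_self_add x y) (by rw [add_comm]; exact le_self_add y x)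

theorem add_idem {a : N} (ha : a + a = a) (x : N) : x + a = x ⊔ a := by
  refine le_antisymm ?_ (sup_le_add x a)
  have h : a + (x ⊔ a) = x ⊔ a := by
    rw [sup_comm, sup_def, ← add_assoc, ha]
  rw [add_comm, ← h]
  exact add_mono le_rfl le_sup_left

theorem sup_compl_idem {a : N} (ha : a + a = a) : a ⊔ aᶜ = 1 := by
  rw [sup_def, compl_compl', ha, add_compl']

theorem inf_compl_idem {a : N} (ha : a + a = a) : a ⊓ aᶜ = 0 := by
  have h := compl_sup' a aᶜ
  rw [sup_compl_idem ha, compl_one', compl_compl'] at h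
  rw [inf_comm, ← h]

theorem compl_idem {a : N} (ha : a + a = a) : aᶜ + aᶜ = aᶜ := by
  have h1 : aᶜ ⊔ a = 1 := by rw [sup_comm, sup_compl_idem ha]
  refine le_antisymm ?_ (le_self_add _ _)
  rw [le_def, add_comm, ← sup_def, h1]

/-- The relative complement of `x` in the interval `[a, b]`. -/
def relCompl (a b x : N) : N := (xᶜ ⊔ a) ⊓ b

theorem relCompl_mem {a b : N} (hab : a ≤ b) (x : N) : relCompl a b x ∈ Set.Icc a b :=
  ⟨le_inf le_sup_right hab, inf_le_right⟩

theorem isLeast_relCompl {a b x : N} (hb : b + b = b) (hab : a ≤ b)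
    (hx : x ∈ Set.Icc a b) : IsLeast {z | z ∈ Set.Icc a b ∧ x + z = b} (relCompl a b x) := by
  refine ⟨⟨relCompl_mem hab x, ?_⟩, ?_⟩
  · have h1 : x + (xᶜ ⊔ a) = 1 := by
      refine le_antisymm (le_one' _) ?_
      rw [← add_compl' x]
      exact add_mono le_rfl le_sup_left
    rw [relCompl, add_inf', h1, add_idem hb, sup_eq_right.2 hx.2, inf_eq_right.2 (le_one' b)]
  · rintro z ⟨hz, hxz⟩
    rw [relCompl, inf_sup_right]
    refine sup_le ?_ (inf_le_left.trans hz.1)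
    have h1 : xᶜ ⊓ b = (x + bᶜ)ᶜ := by
      rw [add_idem (compl_idem hb), compl_sup', compl_compl']
    have h2 := (odot_le_iff xᶜ b z).2
    rw [compl_compl', hxz] at h2
    rw [h1]
    exact h2 le_rfl

theorem isMVAlgebraOn_Icc {a b : N} (ha : a + a = a) (hb : b + b = b) (hab : a ≤ b) :
    IsMVAlgebraOn (Set.Icc a b) (· + ·) (relCompl a b) a b where
  zero_mem := ⟨le_rfl, hab⟩
  one_mem := ⟨hab, le_rfl⟩
  add_mem x hx y hy := ⟨hx.1.trans (le_self_add _ _), (add_mono hx.2 hy.2).trans hb.le⟩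
  neg_mem x _ := relCompl_mem hab x
  add_assoc x _ y _ z _ := add_assoc x y z
  add_comm x _ y _ := add_comm x y
  add_zero x hx := (add_idem ha x).trans (sup_eq_left.2 hx.1)
  neg_neg x hx := by
    show (((xᶜ ⊔ a) ⊓ b)ᶜ ⊔ a) ⊓ b = x
    rw [compl_inf', compl_sup', compl_compl', sup_right_comm, sup_inf_right,
      sup_comm aᶜ a, sup_compl_idem ha, sup_eq_left.2 hx.1, inf_eq_left.2 (le_one' x),
      inf_sup_right, inf_eq_left.2 hx.2, inf_comm, inf_compl_idem hb]
    exact sup_eq_left.2 (zero_le' x)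
  neg_zero := by
    show (aᶜ ⊔ a) ⊓ b = b
    rw [sup_comm, sup_compl_idem ha]
    exact inf_eq_right.2 (le_one' b)
  add_one x hx := (add_idem hb x).trans (sup_eq_right.2 hx.2)
  luk := by
    have key : ∀ x ∈ Set.Icc a b, ∀ y ∈ Set.Icc a b,
        x + relCompl a b (x + relCompl a b y) = x ⊔ y := by
      intro x hx y hy
      have hxa : x + a = x := (add_idem ha x).trans (sup_eq_left.2 hx.1)
      have hxb : x + b = b := (add_idem hb x).trans (sup_eq_right.2 hx.2)
      have h1 : x + relCompl a b y = (x + yᶜ) ⊓ b := by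
        rw [relCompl, add_inf', hxb, ← add_idem ha, ← add_assoc, add_right_comm, hxa]
      have h2 : relCompl a b ((x + yᶜ) ⊓ b) = ((x + yᶜ)ᶜ + bᶜ + a) ⊓ b := by
        rw [relCompl, compl_inf', ← add_idem (compl_idem hb), ← add_idem ha]
      have h3 : x + ((x + yᶜ)ᶜ + bᶜ + a) = (x ⊔ y) ⊔ bᶜ := by
        rw [← add_idem (compl_idem hb), sup_def x y]
        calc x + ((x + yᶜ)ᶜ + bᶜ + a) = (x + a) + (x + yᶜ)ᶜ + bᶜ := by abel
          _ = _ := by rw [hxa]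
      rw [h1, h2, add_inf', hxb, h3, inf_sup_right, inf_comm bᶜ, inf_compl_idem hb,
        inf_eq_left.2 (sup_le hx.2 hy.2)]
      exact sup_eq_left.2 (zero_le' _)
    intro x hx y hy
    show x + relCompl a b (x + relCompl a b y) = y + relCompl a b (y + relCompl a b x)
    rw [key x hx y hy, key y hy x hx, sup_comm]

/-- An ideal: a non-empty down-set closed under `⊕`. -/
structure IsIdeal (I : Set N) : Prop where
  nonempty : I.Nonempty
  down : ∀ x y : N, x ≤ y → y ∈ I → x ∈ I
  add_mem : ∀ x ∈ I, ∀ y ∈ I, x + y ∈ I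

/-- A maximal ideal: a proper ideal not strictly contained in another proper ideal. -/
structure IsMaximalIdeal (I : Set N) : Prop extends IsIdeal I where
  ne_univ : I ≠ Set.univ
  maximal : ∀ J : Set N, IsIdeal J → J ≠ Set.univ → I ⊆ J → J = I

/-- Every element of `I` lies below an idempotent element that belongs to `I`. -/
def HasEnoughIdempotents (I : Set N) : Prop :=
  ∀ x ∈ I, ∃ a ∈ I, a + a = a ∧ x ≤ a

end MVAlgebra

namespace MVHom

variable {N₁ N₂ : Type u} [MVAlgebra N₁] [MVAlgebra N₂] (f : MVHom N₁ N₂)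

theorem map_sup (x y : N₁) : f.toFun (x ⊔ y) = f.toFun x ⊔ f.toFun y := by
  rw [MVAlgebra.sup_def, MVAlgebra.sup_def]
  simp only [f.map_add, f.map_compl]

theorem map_inf (x y : N₁) : f.toFun (x ⊓ y) = f.toFun x ⊓ f.toFun y := by
  rw [MVAlgebra.inf_def, MVAlgebra.inf_def]
  simp only [f.map_add, f.map_compl]

end MVHom

/-! ### EMV-algebras -/

/-- For `x ∈ [a, b]`, `lam a b x` is `λ_{a,b}(x) = min {z ∈ [a, b] | x ⊕ z = b}`
(a junk value if that minimum does not exist; its existence is demanded in `EMVAlgebra`). -/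
noncomputable def lam {M : Type u} [DistribLattice M] [AddCommMonoid M] (a b x : M) : M :=
  open Classical in
  if h : ∃ z, IsLeast {z | z ∈ Set.Icc a b ∧ x + z = b} z then h.choose else 0

theorem lam_eq {M : Type u} [DistribLattice M] [AddCommMonoid M] {a b x z : M}
    (h : IsLeast {z | z ∈ Set.Icc a b ∧ x + z = b} z) : lam a b x = z := by
  have h' : ∃ z, IsLeast {z | z ∈ Set.Icc a b ∧ x + z = b} z := ⟨z, h⟩
  rw [lam, dif_pos h']
  exact h'.choose_spec.unique h

/-- An EMV-algebra `(M; ∨, ∧, ⊕, 0)`; `⊕` is written `+`. -/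
class EMVAlgebra (M : Type u) extends DistribLattice M, AddCommMonoid M where
  zero_le' : ∀ x : M, 0 ≤ x
  add_le_add_right' : ∀ x y z : M, x ≤ y → x + z ≤ y + z
  exists_lam : ∀ a b : M, a + a = a → b + b = b → a ≤ b → ∀ x ∈ Set.Icc a b,
    ∃ z, IsLeast {z | z ∈ Set.Icc a b ∧ x + z = b} z
  isMVAlgebraOn_Icc : ∀ a b : M, a + a = a → b + b = b → a ≤ b →
    IsMVAlgebraOn (Set.Icc a b) (· + ·) (lam a b) a b
  enough_idempotents : ∀ x : M, ∃ a : M, a + a = a ∧ x ≤ a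

/-- Homomorphisms of EMV-algebras. -/
@[ext]
structure EMVHom (M₁ M₂ : Type u) [EMVAlgebra M₁] [EMVAlgebra M₂] where
  toFun : M₁ → M₂
  map_sup : ∀ x y, toFun (x ⊔ y) = toFun x ⊔ toFun y
  map_inf : ∀ x y, toFun (x ⊓ y) = toFun x ⊓ toFun y
  map_add : ∀ x y, toFun (x + y) = toFun x + toFun y
  map_zero : toFun 0 = 0
  map_lam : ∀ b x, b + b = b → x ≤ b → toFun (lam 0 b x) = lam 0 (toFun b) (toFun x)

/-- An EMV-algebra is proper if it has no top element. -/
def EMVAlgebra.IsProper (M : Type u) [EMVAlgebra M] : Prop :=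
  ¬ ∃ t : M, ∀ x : M, x ≤ t

/-! ### An ideal with enough idempotents is an EMV-algebra -/

namespace MVAlgebra

variable {N : Type u} [MVAlgebra N]

/-- The lattice operations of the MV-algebra restricted to an ideal. -/
@[reducible]
def IsIdeal.distribLattice {I : Set N} (hI : IsIdeal I) : DistribLattice I where
  le x y := (x : N) ≤ y
  le_refl x := le_refl (x : N)
  le_trans x y z h h' := le_trans (a := (x : N)) h h'
  le_antisymm x y h h' := Subtype.ext (le_antisymm (a := (x : N)) h h')
  sup x y := ⟨x ⊔ y, hI.down _ _ (sup_le_add _ _) (hI.add_mem _ x.2 _ y.2)⟩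
  inf x y := ⟨x ⊓ y, hI.down _ _ inf_le_left x.2⟩
  le_sup_left x y := le_sup_left (a := (x : N))
  le_sup_right x y := le_sup_right (a := (x : N))
  sup_le x y z h h' := sup_le (a := (x : N)) h h'
  inf_le_left x y := inf_le_left (a := (x : N))
  inf_le_right x y := inf_le_right (a := (x : N))
  le_inf x y z h h' := le_inf (α := N) h h'
  le_sup_inf x y z := le_sup_inf (x := (x : N))

/-- The operation `⊕` of the MV-algebra restricted to an ideal. -/
@[reducible]
def IsIdeal.addCommMonoid {I : Set N} (hI : IsIdeal I) : AddCommMonoid I :=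
  letI : Add I := ⟨fun x y => ⟨x + y, hI.add_mem _ x.2 _ y.2⟩⟩
  letI : Zero I := ⟨⟨0, hI.nonempty.elim fun x hx => hI.down _ x (zero_le' x) hx⟩⟩
  { add_assoc := fun x y z => Subtype.ext (add_assoc (x : N) y z)
    zero_add := fun x => Subtype.ext (zero_add (x : N))
    add_zero := fun x => Subtype.ext (add_zero (x : N))
    add_comm := fun x y => Subtype.ext (add_comm (x : N) y)
    nsmul := nsmulRec }

theorem IsIdeal.relCompl_mem {I : Set N} (hI : IsIdeal I) (b : I) (a x : N) :
    relCompl a (b : N) x ∈ I :=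
  hI.down _ _ inf_le_right b.2

theorem IsIdeal.isLeast {I : Set N} (hI : IsIdeal I) {a b x : I} (hb : (b : N) + b = b) (hab : (a : N) ≤ b)
    (hx : (x : N) ∈ Set.Icc (a : N) b) :
    letI := hI.distribLattice
    letI := hI.addCommMonoid
    IsLeast {z : I | z ∈ Set.Icc a b ∧ x + z = b}
      ⟨relCompl (a : N) b x, hI.relCompl_mem _ _ _⟩ := by
  obtain ⟨⟨h1, h2⟩, h3⟩ := isLeast_relCompl hb hab hx
  refine ⟨⟨h1, Subtype.ext h2⟩, ?_⟩
  rintro z ⟨hz, hxz⟩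
  exact h3 ⟨hz, congrArg Subtype.val hxz⟩

theorem IsIdeal.lam_coe {I : Set N} (hI : IsIdeal I) {a b x : I} (hb : (b : N) + b = b) (hab : (a : N) ≤ b)
    (hx : (x : N) ∈ Set.Icc (a : N) b) :
    letI := hI.distribLattice
    letI := hI.addCommMonoid
    lam a b x = ⟨relCompl (a : N) b x, hI.relCompl_mem _ _ _⟩ := by
  let := hI.distribLattice
  let := hI.addCommMonoid
  exact lam_eq (hI.isLeast hb hab hx)

/-- The EMV-algebra structure, with the inherited operations, on an ideal that has enough
idempotent elements. -/
@[reducible]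
def IsIdeal.emvAlgebra {I : Set N} (hI : IsIdeal I) (hE : HasEnoughIdempotents I) :
    EMVAlgebra I where
  __ := hI.distribLattice
  __ := hI.addCommMonoid
  zero_le' x := zero_le' (x : N)
  add_le_add_right' x y z h := add_mono (x := (x : N)) h le_rfl
  exists_lam a b _ hb hab x hx :=
    ⟨_, hI.isLeast (a := a) (b := b) (congrArg Subtype.val hb) hab hx⟩
  isMVAlgebraOn_Icc a b ha hb hab := by
    let := hI.distribLattice
    let := hI.addCommMonoid
    have hb' : (b : N) + b = b := congrArg Subtype.val hb
    have H := MVAlgebra.isMVAlgebraOn_Icc (congrArg Subtype.val ha) hb' hab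
    have hl : ∀ x ∈ Set.Icc a b, ((lam a b x : I) : N) = relCompl (a : N) b x :=
      fun x hx => congrArg Subtype.val (hI.lam_coe hb' hab hx)
    have hm : ∀ x ∈ Set.Icc a b, lam a b x ∈ Set.Icc a b := fun x hx => by
      rw [hI.lam_coe hb' hab hx]
      exact MVAlgebra.relCompl_mem hab (x : N)
    have hadd : ∀ x ∈ Set.Icc a b, ∀ y ∈ Set.Icc a b, x + y ∈ Set.Icc a b :=
      fun x hx y hy => H.add_mem x hx y hy
    have hc : ∀ x y : I, ((x + y : I) : N) = (x : N) + y := fun _ _ => rfl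
    have hluk : ∀ x ∈ Set.Icc a b, ∀ y ∈ Set.Icc a b,
        ((x + lam a b (x + lam a b y) : I) : N)
          = (x : N) + relCompl (a : N) b ((x : N) + relCompl (a : N) b y) := by
      intro x hx y hy
      rw [hc, hl _ (hadd x hx _ (hm y hy)), hc, hl y hy]
    exact
      { zero_mem := H.zero_mem
        one_mem := H.one_mem
        add_mem := hadd
        neg_mem := hm
        add_assoc := fun x _ y _ z _ => add_assoc x y z
        add_comm := fun x _ y _ => add_comm x y
        add_zero := fun x hx => Subtype.ext (H.add_zero x hx)
        neg_neg := fun x hx => Subtype.ext (by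
          rw [hl _ (hm x hx), hl x hx]
          exact H.neg_neg x hx)
        neg_zero := Subtype.ext (by
          rw [hl a ⟨le_rfl, hab⟩]
          exact H.neg_zero)
        add_one := fun x hx => Subtype.ext (H.add_one x hx)
        luk := fun x hx y hy => Subtype.ext (by
          show ((x + lam a b (x + lam a b y) : I) : N) = ((y + lam a b (y + lam a b x) : I) : N)
          rw [hluk x hx y hy, hluk y hy x hx]
          exact H.luk x hx y hy) }
  enough_idempotents x := by
    obtain ⟨a, haI, ha, hxa⟩ := hE x x.2
    exact ⟨⟨a, haI⟩, Subtype.ext ha, hxa⟩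

end MVAlgebra

/-! ### The categories and the functor -/

/-- The objects of `PEMV`: proper EMV-algebras. -/
structure PEMV : Type (u + 1) where
  M : Type u
  [emv : EMVAlgebra M]
  proper : EMVAlgebra.IsProper M

attribute [instance] PEMV.emv

/-- The category of proper EMV-algebras and EMV-homomorphisms. -/
instance PEMV.category : Category.{u} PEMV.{u} where
  Hom X Y := EMVHom X.M Y.M
  id X :=
    { toFun := fun x => x
      map_sup := fun _ _ => rfl
      map_inf := fun _ _ => rfl
      map_add := fun _ _ => rfl
      map_zero := rfl
      map_lam := fun _ _ _ _ => rfl }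
  comp {X Y Z} f g :=
    { toFun := fun x => g.toFun (f.toFun x)
      map_sup := fun x y => by rw [f.map_sup, g.map_sup]
      map_inf := fun x y => by rw [f.map_inf, g.map_inf]
      map_add := fun x y => by rw [f.map_add, g.map_add]
      map_zero := by rw [f.map_zero, g.map_zero]
      map_lam := fun b x hb hx => by
        rw [f.map_lam b x hb hx, g.map_lam _ _ (by rw [← f.map_add, hb])]
        rw [← sup_eq_right, ← f.map_sup, sup_eq_right.2 hx] }

/-- The objects of `PMV`: pairs `(N, I)` with `I` a maximal ideal of the MV-algebra `N` that has
enough idempotent elements and no greatest element, such that `N = I ∪ I'`. -/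
structure PMV : Type (u + 1) where
  N : Type u
  [mv : MVAlgebra N]
  I : Set N
  isMaximal : MVAlgebra.IsMaximalIdeal I
  enough : MVAlgebra.HasEnoughIdempotents I
  cover : ∀ x : N, x ∈ I ∨ ∃ y ∈ I, x = yᶜ
  no_top : ¬ ∃ t ∈ I, ∀ x ∈ I, x ≤ t

attribute [instance] PMV.mv

/-- The morphisms of `PMV`: MV-homomorphisms `φ : N₁ → N₂` with `φ(I₁) ⊆ I₂`. -/
@[ext]
structure PMV.Hom (X Y : PMV.{u}) extends MVHom X.N Y.N where
  map_mem : ∀ x ∈ X.I, toFun x ∈ Y.I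

instance PMV.category : Category.{u} PMV.{u} where
  Hom X Y := PMV.Hom X Y
  id X :=
    { toFun := fun x => x
      map_add := fun _ _ => rfl
      map_compl := fun _ => rfl
      map_zero := rfl
      map_one := rfl
      map_mem := fun _ hx => hx }
  comp {X Y Z} f g :=
    { toFun := fun x => g.toFun (f.toFun x)
      map_add := fun x y => by rw [f.map_add, g.map_add]
      map_compl := fun x => by rw [f.map_compl, g.map_compl]
      map_zero := by rw [f.map_zero, g.map_zero]
      map_one := by rw [f.map_one, g.map_one]
      map_mem := fun x hx => g.map_mem _ (f.map_mem x hx) }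

/-- The EMV-algebra `I` of an object `(N, I)` of `PMV`. -/
instance PMV.emvAlgebra (X : PMV.{u}) : EMVAlgebra X.I :=
  X.isMaximal.toIsIdeal.emvAlgebra X.enough

/-- The restriction of a morphism `φ : (N₁, I₁) → (N₂, I₂)` to an EMV-homomorphism `I₁ → I₂`. -/
def PMV.Hom.restrict {X Y : PMV.{u}} (φ : PMV.Hom X Y) : EMVHom X.I Y.I where
  toFun x := ⟨φ.toFun x, φ.map_mem x x.2⟩
  map_sup x y := Subtype.ext (φ.toMVHom.map_sup x y)
  map_inf x y := Subtype.ext (φ.toMVHom.map_inf x y)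
  map_add x y := Subtype.ext (φ.map_add x y)
  map_zero := Subtype.ext φ.map_zero
  map_lam b x hb hx := by
    have hb' : (b : X.N) + b = b := congrArg Subtype.val hb
    have hx' : (x : X.N) ≤ b := hx
    have hφb : φ.toFun b + φ.toFun b = φ.toFun b := by rw [← φ.map_add, hb']
    have hφx : φ.toFun x ≤ φ.toFun b := by
      rw [← sup_eq_right, ← φ.toMVHom.map_sup, sup_eq_right.2 hx']
    have e1 := X.isMaximal.toIsIdeal.lam_coe (a := 0) (b := b) (x := x) hb'
      (MVAlgebra.zero_le' _) ⟨MVAlgebra.zero_le' _, hx'⟩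
    have e2 := Y.isMaximal.toIsIdeal.lam_coe (a := 0) (b := ⟨φ.toFun b, φ.map_mem b b.2⟩)
      (x := ⟨φ.toFun x, φ.map_mem x x.2⟩) hφb
      (MVAlgebra.zero_le' _) ⟨MVAlgebra.zero_le' _, hφx⟩
    refine Subtype.ext ?_
    refine Eq.trans ?_ (congrArg Subtype.val e2).symm
    refine (congrArg (fun z : X.I => φ.toFun z) e1).trans ?_
    show φ.toFun (((x : X.N)ᶜ ⊔ 0) ⊓ b) = ((φ.toFun x)ᶜ ⊔ 0) ⊓ φ.toFun b
    rw [φ.toMVHom.map_inf, φ.toMVHom.map_sup, φ.map_compl, φ.map_zero]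

/-- The functor `Φ : PMV ⥤ PEMV`, `Φ(N, I) = I`, `Φ(φ) = φ` restricted to `I`. -/
def Phi : PMV.{u} ⥤ PEMV.{u} where
  obj X :=
    { M := X.I
      proper := fun ⟨t, ht⟩ => X.no_top ⟨t, t.2, fun x hx => ht ⟨x, hx⟩⟩ }
  map φ := PMV.Hom.restrict φ
  map_id _ := rfl
  map_comp _ _ := rfl

/-! An equivalence is a functor that is full, faithful and essentially surjective, and everything
rests on one computation. Let `b` be an idempotent of an MV-algebra. For `x, y ≤ b` the elements `x'
⊙ y = (x ⊕ y')'` and `x ⊙ y = (x' ⊕ y')'` again lie below `b`, and they can be written with `⊕` and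
`λ_{0,b}` alone (`compl_add_compl_eq_relCompl`, `compl_compl_add_compl_eq_relCompl`).

Essential surjectivity: given `M`, adjoin a disjoint copy of formal complements and put `x ⊕ y' =
(x' ⊙ y)'`, `x' ⊕ y' = (x ⊙ y)'`, the right sides being computed in some `[0, c]` with `c`
idempotent. The computation, applied inside the MV-algebra `[0, c]`, shows that smaller intervals
give the same result (`lam_add_lam_mono`, `lam_lam_add_lam_mono`). Elements over `[0, c]` then embed
into the product of `[0, c]` with the two-element algebra (`ext_eval`, `eval_add`, `eval_compl`), so
the axioms hold. The elements of `M` form the ideal, which is maximal as the zero class of the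
projection to the two-element algebra.

Fullness and faithfulness: `N` is the disjoint union of `I` and `I'`, so the only candidate for an
extension of `h` is `x' ↦ h(x)'`. It is additive because the mixed sums are complements of EMV-terms
in `I`, which `h` preserves. Surjectivity and injectivity are inherited on each half. -/

/-! ### Relative complements below an idempotent -/

namespace MVAlgebra

variable {N : Type u} [MVAlgebra N]

theorem relCompl_zero_eq {b : N} (hb : b + b = b) (t : N) :
    relCompl 0 b t = (t + bᶜ)ᶜ := by
  rw [relCompl, sup_eq_left.2 (zero_le' tᶜ), add_idem (compl_idem hb), compl_sup', compl_compl']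

/-- Since `b' ≤ y'`, adding `b'` to `y' ∧ b` restores `y'`: by distributivity of `⊕` over `∧` it
gives `(y' ⊕ b') ∧ 1`. -/
theorem relCompl_zero_add_compl {b y : N} (hb : b + b = b) (hy : y ≤ b) :
    relCompl 0 b y + bᶜ = yᶜ := by
  rw [relCompl, sup_eq_left.2 (zero_le' yᶜ), add_comm, add_inf', add_comm bᶜ b, add_compl',
    inf_eq_left.2 (le_one' _), add_comm, add_idem (compl_idem hb), sup_eq_left.2 (compl_anti hy)]

/-- The outer relative complement supplies a summand `b'`, which turns the inner relative complement
of `y` back into `y'`. -/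
theorem compl_add_compl_eq_relCompl {b y : N} (hb : b + b = b) (hy : y ≤ b) (x : N) :
    (x + yᶜ)ᶜ = relCompl 0 b (x + relCompl 0 b y) := by
  rw [relCompl_zero_eq hb (x + _), add_assoc, relCompl_zero_add_compl hb hy]

theorem compl_compl_add_compl_eq_relCompl {b x y : N} (hb : b + b = b) (hx : x ≤ b)
    (hy : y ≤ b) :
    (xᶜ + yᶜ)ᶜ = relCompl 0 b (relCompl 0 b x + relCompl 0 b y) := by
  -- As `b'` is idempotent it may be doubled, so that each of the two inner relative complements
  -- absorbs one copy.
  rw [relCompl_zero_eq hb (_ + _), ← compl_idem hb, add_add_add_comm,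
    relCompl_zero_add_compl hb hx, relCompl_zero_add_compl hb hy]

theorem IsMaximalIdeal.compl_notMem {I : Set N} (hI : IsMaximalIdeal I) {x : N} (hx : x ∈ I) :
    xᶜ ∉ I := fun h =>
  hI.ne_univ (Set.eq_univ_of_forall fun y =>
    hI.down y 1 (le_one' y) (add_compl' x ▸ hI.add_mem _ hx _ h))

end MVAlgebra

/-! ### The intervals `[0, c]` of an EMV-algebra -/

namespace EMVAlgebra

variable {M : Type u} [EMVAlgebra M]

theorem isMVAlgebraOn_Icc_zero {c : M} (hc : c + c = c) :
    IsMVAlgebraOn (Set.Icc 0 c) (· + ·) (lam 0 c) 0 c :=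
  EMVAlgebra.isMVAlgebraOn_Icc 0 c (add_zero 0) hc (EMVAlgebra.zero_le' c)

theorem isLeast_lam {c x : M} (hc : c + c = c) (hx : x ≤ c) :
    IsLeast {z | z ∈ Set.Icc 0 c ∧ x + z = c} (lam 0 c x) := by
  obtain ⟨z, hz⟩ := EMVAlgebra.exists_lam 0 c (add_zero 0) hc (EMVAlgebra.zero_le' c) x
    ⟨EMVAlgebra.zero_le' x, hx⟩
  rwa [lam_eq hz]

theorem lam_le {c x : M} (hc : c + c = c) (hx : x ≤ c) : lam 0 c x ≤ c :=
  (isLeast_lam hc hx).1.1.2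

theorem add_le {c x y : M} (hc : c + c = c) (hx : x ≤ c) (hy : y ≤ c) : x + y ≤ c :=
  ((isMVAlgebraOn_Icc_zero hc).add_mem x ⟨EMVAlgebra.zero_le' x, hx⟩
    y ⟨EMVAlgebra.zero_le' y, hy⟩).2

theorem lam_lam {c x : M} (hc : c + c = c) (hx : x ≤ c) : lam 0 c (lam 0 c x) = x :=
  (isMVAlgebraOn_Icc_zero hc).neg_neg x ⟨EMVAlgebra.zero_le' x, hx⟩

theorem lam_zero {c : M} (hc : c + c = c) : lam 0 c 0 = c :=
  (isMVAlgebraOn_Icc_zero hc).neg_zero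

theorem add_eq_of_le {c x : M} (hc : c + c = c) (hx : x ≤ c) : x + c = c :=
  (isMVAlgebraOn_Icc_zero hc).add_one x ⟨EMVAlgebra.zero_le' x, hx⟩

/-- This identifies the MV-order of `[0, c]` with the order of `M`. For the converse direction, `x =
λ(λ(x))` is the least `z` in `[0, c]` with `λ(x) ⊕ z = c`, and `y` is such a `z`. -/
theorem le_iff_lam_add {c x y : M} (hc : c + c = c) (hx : x ≤ c) (hy : y ≤ c) :
    x ≤ y ↔ lam 0 c x + y = c := by
  have hl := lam_le hc hx
  constructor
  · intro h
    refine le_antisymm (add_le hc hl hy) ?_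
    have h' := EMVAlgebra.add_le_add_right' x y (lam 0 c x) h
    rwa [(isLeast_lam hc hx).1.2, add_comm] at h'
  · intro h
    have h' := (isLeast_lam hc hl).2 ⟨⟨EMVAlgebra.zero_le' y, hy⟩, h⟩
    rwa [lam_lam hc hx] at h'

/-- The MV-algebra `[0, c]` for an idempotent element `c`. -/
@[reducible]
noncomputable def mvAlgebraIcc {c : M} (hc : c + c = c) : MVAlgebra (Set.Icc (0 : M) c) :=
  have H := isMVAlgebraOn_Icc_zero hc
  letI : Add (Set.Icc (0 : M) c) := ⟨fun x y => ⟨x + y, H.add_mem x x.2 y y.2⟩⟩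
  letI : Zero (Set.Icc (0 : M) c) := ⟨⟨0, H.zero_mem⟩⟩
  { add_assoc := fun x y z => Subtype.ext (add_assoc (x : M) y z)
    zero_add := fun x => Subtype.ext (zero_add (x : M))
    add_zero := fun x => Subtype.ext (add_zero (x : M))
    add_comm := fun x y => Subtype.ext (add_comm (x : M) y)
    nsmul := nsmulRec
    one := ⟨c, H.one_mem⟩
    compl := fun x => ⟨lam 0 c x, H.neg_mem x x.2⟩
    compl_compl' := fun x => Subtype.ext (H.neg_neg x x.2)
    compl_zero' := Subtype.ext H.neg_zero
    add_one' := fun x => Subtype.ext (H.add_one x x.2)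
    luk' := fun x y => Subtype.ext (H.luk x x.2 y y.2) }

theorem mvAlgebraIcc_le_iff {c : M} (hc : c + c = c) (x y : Set.Icc (0 : M) c) :
    (@MVAlgebra.instPartialOrder _ (mvAlgebraIcc hc)).le x y ↔ (x : M) ≤ y := by
  rw [le_iff_lam_add hc x.2.2 y.2.2]
  exact Subtype.ext_iff

/-- Both sides are the least solution `z` in `[0, b]` of `x ⊕ z = b`; the orders of `[0, c]` and `M`
agree. -/
theorem relCompl_mvAlgebraIcc {b c : M} (hb : b + b = b) (hc : c + c = c) (hbc : b ≤ c)
    {x : Set.Icc (0 : M) c} (hx : (x : M) ≤ b) :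
    letI := mvAlgebraIcc hc
    ((MVAlgebra.relCompl 0 ⟨b, EMVAlgebra.zero_le' b, hbc⟩ x : Set.Icc (0 : M) c) : M)
      = lam 0 b x := by
  let := mvAlgebraIcc hc
  let b' : Set.Icc (0 : M) c := ⟨b, EMVAlgebra.zero_le' b, hbc⟩
  have hb' : b' + b' = b' := Subtype.ext hb
  have le_iff := mvAlgebraIcc_le_iff hc
  have H := MVAlgebra.isLeast_relCompl (a := 0) (b := b') (x := x) hb' (MVAlgebra.zero_le' b')
    ⟨MVAlgebra.zero_le' x, (le_iff x b').2 hx⟩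
  refine (lam_eq ⟨⟨⟨EMVAlgebra.zero_le' _, (le_iff _ _).1 H.1.1.2⟩,
    congrArg Subtype.val H.1.2⟩, ?_⟩).symm
  rintro z ⟨hz, hxz⟩
  let z' : Set.Icc (0 : M) c := ⟨z, hz.1, hz.2.trans hbc⟩
  exact (le_iff _ z').1 (H.2 ⟨⟨MVAlgebra.zero_le' z', (le_iff z' b').2 hz.2⟩, Subtype.ext hxz⟩)

/-- Inside the MV-algebra `[0, c]` this is the formula for `(x ⊕ y')'` relative to the idempotent
`b`. It makes the truncated difference independent of the interval. -/
theorem lam_add_lam_mono {b c x y : M} (hb : b + b = b) (hc : c + c = c) (hbc : b ≤ c)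
    (hx : x ≤ b) (hy : y ≤ b) :
    lam 0 b (x + lam 0 b y) = lam 0 c (x + lam 0 c y) := by
  let := mvAlgebraIcc hc
  let b' : Set.Icc (0 : M) c := ⟨b, EMVAlgebra.zero_le' b, hbc⟩
  let x' : Set.Icc (0 : M) c := ⟨x, EMVAlgebra.zero_le' x, hx.trans hbc⟩
  let y' : Set.Icc (0 : M) c := ⟨y, EMVAlgebra.zero_le' y, hy.trans hbc⟩
  have hb' : b' + b' = b' := Subtype.ext hb
  have H := congrArg Subtype.val (MVAlgebra.compl_add_compl_eq_relCompl hb'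
    ((mvAlgebraIcc_le_iff hc y' b').2 hy) x')
  have ey : ((MVAlgebra.relCompl 0 b' y' : Set.Icc (0 : M) c) : M) = lam 0 b y :=
    relCompl_mvAlgebraIcc hb hc hbc hy
  have e : ((x' + MVAlgebra.relCompl 0 b' y' : Set.Icc (0 : M) c) : M) = x + lam 0 b y :=
    congrArg (x + ·) ey
  rw [← e]
  refine (relCompl_mvAlgebraIcc hb hc hbc ?_).symm.trans H.symm
  rw [e]
  exact add_le hb hx (lam_le hb hy)

theorem lam_lam_add_lam_mono {b c x y : M} (hb : b + b = b) (hc : c + c = c) (hbc : b ≤ c)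
    (hx : x ≤ b) (hy : y ≤ b) :
    lam 0 b (lam 0 b x + lam 0 b y) = lam 0 c (lam 0 c x + lam 0 c y) := by
  let := mvAlgebraIcc hc
  let b' : Set.Icc (0 : M) c := ⟨b, EMVAlgebra.zero_le' b, hbc⟩
  let x' : Set.Icc (0 : M) c := ⟨x, EMVAlgebra.zero_le' x, hx.trans hbc⟩
  let y' : Set.Icc (0 : M) c := ⟨y, EMVAlgebra.zero_le' y, hy.trans hbc⟩
  have hb' : b' + b' = b' := Subtype.ext hb
  have H := congrArg Subtype.val (MVAlgebra.compl_compl_add_compl_eq_relCompl hb'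
    ((mvAlgebraIcc_le_iff hc x' b').2 hx) ((mvAlgebraIcc_le_iff hc y' b').2 hy))
  have ex : ((MVAlgebra.relCompl 0 b' x' : Set.Icc (0 : M) c) : M) = lam 0 b x :=
    relCompl_mvAlgebraIcc hb hc hbc hx
  have ey : ((MVAlgebra.relCompl 0 b' y' : Set.Icc (0 : M) c) : M) = lam 0 b y :=
    relCompl_mvAlgebraIcc hb hc hbc hy
  have e : ((MVAlgebra.relCompl 0 b' x' + MVAlgebra.relCompl 0 b' y' : Set.Icc (0 : M) c) : M)
      = lam 0 b x + lam 0 b y := congrArg₂ (· + ·) ex ey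
  rw [← e]
  refine (relCompl_mvAlgebraIcc hb hc hbc ?_).symm.trans H.symm
  rw [e]
  exact add_le hb (lam_le hb hx) (lam_le hb hy)

/-! ### Difference and product, independent of the idempotent chosen. -/

/-- A chosen idempotent above an element. -/
noncomputable def cover (x : M) : M := (EMVAlgebra.enough_idempotents x).choose

theorem cover_idem (x : M) : cover x + cover x = cover x :=
  (EMVAlgebra.enough_idempotents x).choose_spec.1

theorem le_cover (x : M) : x ≤ cover x := (EMVAlgebra.enough_idempotents x).choose_spec.2

/-- The truncated difference `x' ⊙ y`. -/
noncomputable def sdiff (y x : M) : M :=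
  lam 0 (cover (x ⊔ y)) (x + lam 0 (cover (x ⊔ y)) y)

/-- The product `x ⊙ y`. -/
noncomputable def odot (x y : M) : M :=
  lam 0 (cover (x ⊔ y)) (lam 0 (cover (x ⊔ y)) x + lam 0 (cover (x ⊔ y)) y)

theorem sdiff_eq {c x y : M} (hc : c + c = c) (hx : x ≤ c) (hy : y ≤ c) :
    sdiff y x = lam 0 c (x + lam 0 c y) := by
  have h := le_cover (x ⊔ y)
  -- Neither the chosen idempotent nor `c` need lie below the other, so both are compared with a
  -- common idempotent above them.
  have hd := le_cover (cover (x ⊔ y) ⊔ c)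
  rw [sdiff, lam_add_lam_mono (cover_idem _) (cover_idem _) (le_sup_left.trans hd)
    (le_sup_left.trans h) (le_sup_right.trans h),
    lam_add_lam_mono hc (cover_idem _) (le_sup_right.trans hd) hx hy]

theorem odot_eq {c x y : M} (hc : c + c = c) (hx : x ≤ c) (hy : y ≤ c) :
    odot x y = lam 0 c (lam 0 c x + lam 0 c y) := by
  have h := le_cover (x ⊔ y)
  have hd := le_cover (cover (x ⊔ y) ⊔ c)
  rw [odot, lam_lam_add_lam_mono (cover_idem _) (cover_idem _) (le_sup_left.trans hd)
    (le_sup_left.trans h) (le_sup_right.trans h),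
    lam_lam_add_lam_mono hc (cover_idem _) (le_sup_right.trans hd) hx hy]

end EMVAlgebra

/-! ### The MV-algebra generated by an EMV-algebra -/

/-- The disjoint union of `M` and a copy of `M` that consists of the formal complements. -/
@[ext]
structure MVExtension (M : Type u) : Type u where
  val : M
  isCompl : Bool

namespace MVExtension

open EMVAlgebra

variable {M : Type u} [EMVAlgebra M]

/-- The interpretation of an element in the interval `[0, c]`. -/
noncomputable def eval (c : M) (s : MVExtension M) : M :=
  bif s.isCompl then lam 0 c s.val else s.val

/-- The cases encode `x ⊕ y' = (y ⊙ x')'` and `x' ⊕ y' = (x ⊙ y)'`, with the outer complement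
recorded by the flag. -/
noncomputable instance : Add (MVExtension M) where
  add s t := ⟨match s.isCompl, t.isCompl with
    | false, false => s.val + t.val
    | false, true => sdiff t.val s.val
    | true, false => sdiff s.val t.val
    | true, true => odot s.val t.val, s.isCompl || t.isCompl⟩

instance : Compl (MVExtension M) where
  compl s := ⟨s.val, !s.isCompl⟩

instance : Zero (MVExtension M) where
  zero := ⟨0, false⟩

instance : One (MVExtension M) where
  one := ⟨0, true⟩

theorem isCompl_add (s t : MVExtension M) : (s + t).isCompl = (s.isCompl || t.isCompl) := rfl

theorem isCompl_compl {M : Type u} (s : MVExtension M) : sᶜ.isCompl = !s.isCompl := rfl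

theorem eval_mem {c : M} (hc : c + c = c) {s : MVExtension M} (hs : s.val ≤ c) :
    s.eval c ∈ Set.Icc 0 c := by
  refine ⟨EMVAlgebra.zero_le' _, ?_⟩
  obtain ⟨x, _ | _⟩ := s
  exacts [hs, lam_le hc hs]

theorem val_add_le {c : M} (hc : c + c = c) {s t : MVExtension M} (hs : s.val ≤ c)
    (ht : t.val ≤ c) : (s + t).val ≤ c := by
  obtain ⟨x, _ | _⟩ := s <;> obtain ⟨y, _ | _⟩ := t
  · exact add_le hc hs ht
  · exact (sdiff_eq hc hs ht).trans_le (lam_le hc (add_le hc hs (lam_le hc ht)))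
  · exact (sdiff_eq hc ht hs).trans_le (lam_le hc (add_le hc ht (lam_le hc hs)))
  · exact (odot_eq hc hs ht).trans_le (lam_le hc (add_le hc (lam_le hc hs) (lam_le hc ht)))

theorem eval_add {c : M} (hc : c + c = c) {s t : MVExtension M} (hs : s.val ≤ c)
    (ht : t.val ≤ c) : (s + t).eval c = s.eval c + t.eval c := by
  obtain ⟨x, _ | _⟩ := s <;> obtain ⟨y, _ | _⟩ := t
  · rfl
  · exact (congrArg (lam 0 c) (sdiff_eq hc hs ht)).trans
      (lam_lam hc (add_le hc hs (lam_le hc ht)))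
  · exact ((congrArg (lam 0 c) (sdiff_eq hc ht hs)).trans
      (lam_lam hc (add_le hc ht (lam_le hc hs)))).trans (add_comm _ _)
  · exact (congrArg (lam 0 c) (odot_eq hc hs ht)).trans
      (lam_lam hc (add_le hc (lam_le hc hs) (lam_le hc ht)))

theorem eval_compl {c : M} (hc : c + c = c) {s : MVExtension M} (hs : s.val ≤ c) :
    sᶜ.eval c = lam 0 c (s.eval c) := by
  obtain ⟨x, _ | _⟩ := s
  exacts [rfl, (lam_lam hc hs).symm]

theorem eval_one {c : M} (hc : c + c = c) : (1 : MVExtension M).eval c = c := lam_zero hc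

/-- Evaluation alone is not injective, since a formal complement and an element of `M` may share a
value in `[0, c]`; the flag separates them. -/
theorem ext_eval {c : M} (hc : c + c = c) {s t : MVExtension M} (hs : s.val ≤ c)
    (ht : t.val ≤ c) (hst : s.isCompl = t.isCompl) (h : s.eval c = t.eval c) : s = t := by
  refine MVExtension.ext ?_ hst
  obtain ⟨x, _ | _⟩ := s <;> obtain ⟨y, _ | _⟩ := t
  · exact h
  · cases hst
  · cases hst
  · rw [← lam_lam hc hs, ← lam_lam hc ht]
    exact congrArg (lam 0 c) h

/-- Each axiom involves finitely many elements, so one idempotent `c` bounds them all. The identity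
is then checked on flags and on values in `[0, c]`. -/
noncomputable instance : MVAlgebra (MVExtension M) where
  add_assoc s t r := by
    obtain ⟨c, hc, h⟩ := EMVAlgebra.enough_idempotents (s.val ⊔ t.val ⊔ r.val)
    have hs := le_sup_left.trans (le_sup_left.trans h)
    have ht := le_sup_right.trans (le_sup_left.trans h)
    have hr := le_sup_right.trans h
    have hst := val_add_le hc hs ht
    have htr := val_add_le hc ht hr
    refine ext_eval hc (val_add_le hc hst hr) (val_add_le hc hs htr) (Bool.or_assoc _ _ _) ?_
    rw [eval_add hc hst hr, eval_add hc hs ht, eval_add hc hs htr, eval_add hc ht hr, add_assoc]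
  add_comm s t := by
    obtain ⟨c, hc, h⟩ := EMVAlgebra.enough_idempotents (s.val ⊔ t.val)
    have hs := le_sup_left.trans h
    have ht := le_sup_right.trans h
    refine ext_eval hc (val_add_le hc hs ht) (val_add_le hc ht hs) (Bool.or_comm _ _) ?_
    rw [eval_add hc hs ht, eval_add hc ht hs, add_comm]
  add_zero s := by
    obtain ⟨c, hc, hs⟩ := EMVAlgebra.enough_idempotents s.val
    have h0 : (0 : MVExtension M).val ≤ c := EMVAlgebra.zero_le' c
    refine ext_eval hc (val_add_le hc hs h0) hs (Bool.or_false _) ?_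
    rw [eval_add hc hs h0]
    exact add_zero _
  zero_add s := by
    obtain ⟨c, hc, hs⟩ := EMVAlgebra.enough_idempotents s.val
    have h0 : (0 : MVExtension M).val ≤ c := EMVAlgebra.zero_le' c
    refine ext_eval hc (val_add_le hc h0 hs) hs (Bool.false_or _) ?_
    rw [eval_add hc h0 hs]
    exact zero_add _
  nsmul := nsmulRec
  compl_compl' s := MVExtension.ext rfl (Bool.not_not _)
  compl_zero' := rfl
  add_one' s := by
    obtain ⟨c, hc, hs⟩ := EMVAlgebra.enough_idempotents s.val
    have h1 : (1 : MVExtension M).val ≤ c := EMVAlgebra.zero_le' c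
    refine ext_eval hc (val_add_le hc hs h1) h1 (Bool.or_true _) ?_
    rw [eval_add hc hs h1, eval_one hc]
    exact add_eq_of_le hc (eval_mem hc hs).2
  luk' s t := by
    obtain ⟨c, hc, h⟩ := EMVAlgebra.enough_idempotents (s.val ⊔ t.val)
    have hs : s.val ≤ c := le_sup_left.trans h
    have ht : t.val ≤ c := le_sup_right.trans h
    have key : ∀ s t : MVExtension M, s.val ≤ c → t.val ≤ c →
        (s + (s + tᶜ)ᶜ).val ≤ c ∧ (s + (s + tᶜ)ᶜ).eval c =
          s.eval c + lam 0 c (s.eval c + lam 0 c (t.eval c)) := by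
      intro s t hs ht
      have htc : tᶜ.val ≤ c := ht
      have hst := val_add_le hc hs htc
      have hst' : (s + tᶜ)ᶜ.val ≤ c := hst
      refine ⟨val_add_le hc hs hst', ?_⟩
      rw [eval_add hc hs hst', eval_compl hc hst, eval_add hc hs htc, eval_compl hc ht]
    refine ext_eval hc (key s t hs ht).1 (key t s ht hs).1 ?_ ?_
    -- On flags the identity is the corresponding one in the two-element Boolean algebra.
    · simp only [isCompl_add, isCompl_compl]
      cases s.isCompl <;> cases t.isCompl <;> rfl
    · rw [(key s t hs ht).2, (key t s ht hs).2]
      exact (isMVAlgebraOn_Icc_zero hc).luk _ (eval_mem hc hs) _ (eval_mem hc ht)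

/-- The sum `x' ⊕ y` always carries the flag of `1`, so it equals `1` exactly when its value `λ(x) ⊕
y` in `[0, c]` is `c`. -/
theorem mk_false_le_iff (x y : M) :
    (⟨x, false⟩ : MVExtension M) ≤ ⟨y, false⟩ ↔ x ≤ y := by
  obtain ⟨c, hc, h⟩ := EMVAlgebra.enough_idempotents (x ⊔ y)
  have hx := le_sup_left.trans h
  have hy := le_sup_right.trans h
  have hx' : (⟨x, false⟩ : MVExtension M)ᶜ.val ≤ c := hx
  have hy' : (⟨y, false⟩ : MVExtension M).val ≤ c := hy
  have e : ((⟨x, false⟩ : MVExtension M)ᶜ + ⟨y, false⟩).eval c = lam 0 c x + y :=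
    eval_add hc hx' hy'
  rw [MVAlgebra.le_def, le_iff_lam_add hc hx hy, ← e]
  constructor
  · intro h
    rw [h, eval_one hc]
  · intro h
    exact ext_eval hc (val_add_le hc hx' hy') (EMVAlgebra.zero_le' c) rfl
      (h.trans (eval_one hc).symm)

theorem isMaximalIdeal : MVAlgebra.IsMaximalIdeal {s : MVExtension M | s.isCompl = false} where
  nonempty := ⟨0, rfl⟩
  down s t hst ht := by
    have h : (!s.isCompl || t.isCompl) = true := congrArg isCompl hst
    have ht' : t.isCompl = false := ht
    rw [ht', Bool.or_false, Bool.not_eq_true'] at h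
    exact h
  add_mem s hs t ht := (congrArg₂ or hs ht : (s.isCompl || t.isCompl) = (false || false))
  ne_univ h := by
    have h1 : (1 : MVExtension M) ∈ {s : MVExtension M | s.isCompl = false} := h ▸ Set.mem_univ _
    cases h1
  maximal J hJ hne hIJ := by
    refine (hIJ.antisymm fun s hs => ?_).symm
    -- An `s ∈ J` outside the ideal has its complement in the ideal, hence in `J`, so `1 = s ⊕ s' ∈
    -- J`.
    by_contra hsI
    have hsc : sᶜ ∈ J := hIJ (by
      show (!s.isCompl) = false
      rw [eq_true_of_ne_false hsI]; rfl)
    exact hne (Set.eq_univ_of_forall fun y => hJ.down y 1 (MVAlgebra.le_one' y)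
      (MVAlgebra.add_compl' s ▸ hJ.add_mem _ hs _ hsc))

end MVExtension

/-! ### Essential surjectivity. -/

/-- The object of `PMV` that belongs to a proper EMV-algebra. -/
noncomputable def PEMV.toPMV (X : PEMV.{u}) : PMV.{u} where
  N := MVExtension X.M
  I := {s | s.isCompl = false}
  isMaximal := MVExtension.isMaximalIdeal
  enough := by
    rintro ⟨x, p⟩ (rfl : p = false)
    obtain ⟨a, ha, hxa⟩ := EMVAlgebra.enough_idempotents x
    exact ⟨⟨a, false⟩, rfl, MVExtension.ext ha rfl, (MVExtension.mk_false_le_iff x a).2 hxa⟩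
  cover := by
    rintro ⟨x, _ | _⟩
    exacts [Or.inl rfl, Or.inr ⟨⟨x, false⟩, rfl, rfl⟩]
  no_top := by
    rintro ⟨⟨t, p⟩, (rfl : p = false), ht⟩
    exact X.proper ⟨t, fun x => (MVExtension.mk_false_le_iff x t).1 (ht ⟨x, false⟩ rfl)⟩

/-- An additive order isomorphism of EMV-algebras is an EMV-homomorphism. -/
def EMVHom.ofOrderIso {M₁ M₂ : Type u} [EMVAlgebra M₁] [EMVAlgebra M₂] (e : M₁ ≃o M₂)
    (hadd : ∀ x y, e (x + y) = e x + e y) : EMVHom M₁ M₂ :=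
  have h0 : e 0 = 0 := le_antisymm
    (by rw [← e.apply_symm_apply 0]; exact e.monotone (EMVAlgebra.zero_le' _))
    (EMVAlgebra.zero_le' _)
  { toFun := e
    map_sup := e.map_sup
    map_inf := e.map_inf
    map_add := hadd
    map_zero := h0
    map_lam := fun b x hb hx => by
      -- `λ_{0,b}(x)` is characterised by order and `⊕` alone, so the isomorphism carries the
      -- minimum to the minimum.
      have H := EMVAlgebra.isLeast_lam hb hx
      refine (lam_eq ⟨⟨⟨EMVAlgebra.zero_le' _, e.monotone H.1.1.2⟩, ?_⟩, ?_⟩).symm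
      · rw [← hadd, H.1.2]
      · rintro z ⟨hz, hxz⟩
        rw [← e.le_symm_apply]
        refine H.2 ⟨⟨EMVAlgebra.zero_le' _, ?_⟩, e.injective ?_⟩
        · rw [e.symm_apply_le]; exact hz.2
        · rw [hadd, e.apply_symm_apply, hxz] }

/-- The ideal of `X.toPMV` is order isomorphic to `X`. -/
noncomputable def PEMV.orderIso (X : PEMV.{u}) : (Phi.obj X.toPMV).M ≃o X.M where
  toFun s := s.1.val
  invFun x := ⟨⟨x, false⟩, rfl⟩
  left_inv := by
    rintro ⟨⟨x, p⟩, (rfl : p = false)⟩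
    rfl
  right_inv _ := rfl
  map_rel_iff' := by
    rintro ⟨⟨x, p⟩, (rfl : p = false)⟩ ⟨⟨y, q⟩, (rfl : q = false)⟩
    exact (MVExtension.mk_false_le_iff x y).symm

theorem PEMV.orderIso_add (X : PEMV.{u}) (s t : (Phi.obj X.toPMV).M) :
    X.orderIso (s + t) = X.orderIso s + X.orderIso t := by
  obtain ⟨⟨x, p⟩, (rfl : p = false)⟩ := s
  obtain ⟨⟨y, q⟩, (rfl : q = false)⟩ := t
  rfl

/-- Every proper EMV-algebra is isomorphic to the ideal of its MV-extension. -/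
noncomputable def PEMV.iso (X : PEMV.{u}) : Phi.obj X.toPMV ≅ X where
  hom := EMVHom.ofOrderIso X.orderIso X.orderIso_add
  inv := EMVHom.ofOrderIso X.orderIso.symm fun x y => X.orderIso.injective (by
    rw [X.orderIso_add]
    simp only [OrderIso.apply_symm_apply])
  hom_inv_id := EMVHom.ext (funext fun x => X.orderIso.symm_apply_apply x)
  inv_hom_id := EMVHom.ext (funext fun x => X.orderIso.apply_symm_apply x)

/-! ### Extension of homomorphisms -/

namespace PMV

variable {X Y : PMV.{u}}

theorem compl_mem {x : X.N} (hx : x ∉ X.I) : xᶜ ∈ X.I := by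
  obtain h | ⟨y, hy, rfl⟩ := X.cover x
  · exact absurd h hx
  · rwa [MVAlgebra.compl_compl']

theorem lam_zero_coe {b x : X.I} (hb : b + b = b) (hx : x ≤ b) :
    ((lam 0 b x : X.I) : X.N) = MVAlgebra.relCompl 0 (b : X.N) x :=
  congrArg Subtype.val (X.isMaximal.toIsIdeal.lam_coe (a := 0) (b := b) (x := x)
    (congrArg Subtype.val hb) (MVAlgebra.zero_le' _) ⟨MVAlgebra.zero_le' _, hx⟩)

/-- An element formed with complements of `N` is here a term of the EMV-algebra `I`, to which an
EMV-homomorphism can be applied. -/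
theorem compl_add_compl_coe {b x y : X.I} (hb : b + b = b) (hx : x ≤ b) (hy : y ≤ b) :
    ((lam 0 b (x + lam 0 b y) : X.I) : X.N) = ((x : X.N) + (y : X.N)ᶜ)ᶜ := by
  rw [lam_zero_coe hb (EMVAlgebra.add_le hb hx (EMVAlgebra.lam_le hb hy)),
    MVAlgebra.compl_add_compl_eq_relCompl (congrArg Subtype.val hb) hy, ← lam_zero_coe hb hy]
  rfl

theorem compl_compl_add_compl_coe {b x y : X.I} (hb : b + b = b) (hx : x ≤ b) (hy : y ≤ b) :
    ((lam 0 b (lam 0 b x + lam 0 b y) : X.I) : X.N) = ((x : X.N)ᶜ + (y : X.N)ᶜ)ᶜ := by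
  rw [lam_zero_coe hb
      (EMVAlgebra.add_le hb (EMVAlgebra.lam_le hb hx) (EMVAlgebra.lam_le hb hy)),
    MVAlgebra.compl_compl_add_compl_eq_relCompl (congrArg Subtype.val hb) hx hy,
    ← lam_zero_coe hb hx, ← lam_zero_coe hb hy]
  rfl

theorem _root_.EMVHom.monotone {M₁ M₂ : Type u} [EMVAlgebra M₁] [EMVAlgebra M₂]
    (h : EMVHom M₁ M₂) {x y : M₁} (hxy : x ≤ y) : h.toFun x ≤ h.toFun y := by
  rw [← sup_eq_right, ← h.map_sup, sup_eq_right.2 hxy]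

variable (h : EMVHom X.I Y.I)

open Classical in
/-- The extension of an EMV-homomorphism of the ideals to the MV-algebras. -/
noncomputable def extendFun (x : X.N) : Y.N :=
  if hx : x ∈ X.I then h.toFun ⟨x, hx⟩ else (h.toFun ⟨xᶜ, compl_mem hx⟩ : Y.N)ᶜ

theorem extendFun_coe (x : X.I) : extendFun h x = h.toFun x := dif_pos x.2

theorem extendFun_compl_coe (x : X.I) : extendFun h (x : X.N)ᶜ = (h.toFun x : Y.N)ᶜ := by
  rw [extendFun, dif_neg (X.isMaximal.compl_notMem x.2)]
  simp only [MVAlgebra.compl_compl']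

theorem coe_or_compl (x : X.N) : (∃ a : X.I, x = a) ∨ ∃ a : X.I, x = (a : X.N)ᶜ := by
  obtain hx | ⟨y, hy, rfl⟩ := X.cover x
  exacts [Or.inl ⟨⟨x, hx⟩, rfl⟩, Or.inr ⟨⟨y, hy⟩, rfl⟩]

theorem extendFun_compl (x : X.N) : extendFun h xᶜ = (extendFun h x)ᶜ := by
  obtain ⟨a, rfl⟩ | ⟨a, rfl⟩ := coe_or_compl x
  · rw [extendFun_compl_coe, extendFun_coe]
  · rw [extendFun_compl_coe, MVAlgebra.compl_compl', MVAlgebra.compl_compl', extendFun_coe]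

theorem extendFun_coe_add_compl (x y : X.I) :
    extendFun h ((x : X.N) + (y : X.N)ᶜ) = h.toFun x + (h.toFun y : Y.N)ᶜ := by
  obtain ⟨b, hb, hxy⟩ := EMVAlgebra.enough_idempotents (x ⊔ y)
  have hx := le_sup_left.trans hxy
  have hy := le_sup_right.trans hxy
  have hhb : h.toFun b + h.toFun b = h.toFun b := by rw [← h.map_add, hb]
  -- The sum is the complement of an EMV-term in `I`; `h` is pushed through that term, and the same
  -- formula is read backwards in the target with the idempotent `h(b)`.
  rw [← MVAlgebra.compl_compl' ((x : X.N) + (y : X.N)ᶜ), ← compl_add_compl_coe hb hx hy,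
    extendFun_compl_coe, h.map_lam b _ hb (EMVAlgebra.add_le hb hx (EMVAlgebra.lam_le hb hy)),
    h.map_add, h.map_lam b y hb hy, compl_add_compl_coe hhb (h.monotone hx) (h.monotone hy),
    MVAlgebra.compl_compl']

theorem extendFun_compl_add_compl (x y : X.I) :
    extendFun h ((x : X.N)ᶜ + (y : X.N)ᶜ) = (h.toFun x : Y.N)ᶜ + (h.toFun y : Y.N)ᶜ := by
  obtain ⟨b, hb, hxy⟩ := EMVAlgebra.enough_idempotents (x ⊔ y)
  have hx := le_sup_left.trans hxy
  have hy := le_sup_right.trans hxy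
  have hhb : h.toFun b + h.toFun b = h.toFun b := by rw [← h.map_add, hb]
  rw [← MVAlgebra.compl_compl' ((x : X.N)ᶜ + (y : X.N)ᶜ),
    ← compl_compl_add_compl_coe hb hx hy, extendFun_compl_coe,
    h.map_lam b _ hb
      (EMVAlgebra.add_le hb (EMVAlgebra.lam_le hb hx) (EMVAlgebra.lam_le hb hy)),
    h.map_add, h.map_lam b x hb hx, h.map_lam b y hb hy,
    compl_compl_add_compl_coe hhb (h.monotone hx) (h.monotone hy), MVAlgebra.compl_compl']

theorem extendFun_add (x y : X.N) :
    extendFun h (x + y) = extendFun h x + extendFun h y := by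
  obtain ⟨a, rfl⟩ | ⟨a, rfl⟩ := coe_or_compl x <;> obtain ⟨b, rfl⟩ | ⟨b, rfl⟩ := coe_or_compl y
  · rw [extendFun_coe, extendFun_coe]
    exact (extendFun_coe h (a + b)).trans (congrArg Subtype.val (h.map_add a b))
  · rw [extendFun_coe_add_compl, extendFun_coe, extendFun_compl_coe]
  · rw [add_comm, extendFun_coe_add_compl, extendFun_coe, extendFun_compl_coe, add_comm]
  · rw [extendFun_compl_add_compl, extendFun_compl_coe, extendFun_compl_coe]

theorem extendFun_zero : extendFun h 0 = 0 :=
  (extendFun_coe h 0).trans (congrArg Subtype.val h.map_zero)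

/-- The morphism of `PMV` that extends an EMV-homomorphism of the ideals. -/
noncomputable def extend : PMV.Hom X Y where
  toFun := extendFun h
  map_add := extendFun_add h
  map_compl := extendFun_compl h
  map_zero := extendFun_zero h
  map_one := by rw [← MVAlgebra.compl_zero', extendFun_compl, extendFun_zero,
    MVAlgebra.compl_zero']
  map_mem x hx := by rw [extendFun, dif_pos hx]; exact Subtype.coe_prop _

theorem restrict_extend : (extend h).restrict = h :=
  EMVHom.ext (funext fun x => Subtype.ext (extendFun_coe h x))

/-- Every element of `N` lies in `I` or is the complement of one that does, so a morphism is
determined on `I`. -/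
theorem Hom.restrict_injective :
    Function.Injective (Hom.restrict : PMV.Hom X Y → EMVHom X.I Y.I) := by
  intro φ ψ e
  have key (a : X.I) : φ.toFun a = ψ.toFun a :=
    congrArg (fun f : EMVHom X.I Y.I => (f.toFun a : Y.N)) e
  refine Hom.ext (funext fun x => ?_)
  obtain ⟨a, rfl⟩ | ⟨a, rfl⟩ := coe_or_compl x
  · exact key a
  · rw [φ.map_compl, ψ.map_compl, key]

variable {h}

theorem extendFun_surjective (hs : Function.Surjective h.toFun) :
    Function.Surjective (extendFun h) := by
  intro y
  obtain ⟨b, rfl⟩ | ⟨b, rfl⟩ := coe_or_compl y <;> obtain ⟨a, rfl⟩ := hs b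
  · exact ⟨_, extendFun_coe h a⟩
  · exact ⟨_, extendFun_compl_coe h a⟩

theorem extendFun_injective (hi : Function.Injective h.toFun) :
    Function.Injective (extendFun h) := by
  -- Disjointness of the ideal and its set of complements in the target rules out a collision
  -- between the two halves.
  have aux (a b : Y.I) : (a : Y.N) ≠ (b : Y.N)ᶜ := fun e =>
    Y.isMaximal.compl_notMem b.2 (e ▸ a.2)
  intro x y e
  obtain ⟨a, rfl⟩ | ⟨a, rfl⟩ := coe_or_compl x <;>
    obtain ⟨b, rfl⟩ | ⟨b, rfl⟩ := coe_or_compl y <;>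
    simp only [extendFun_coe, extendFun_compl_coe] at e
  · rw [hi (Subtype.ext e)]
  · exact absurd e (aux _ _)
  · exact absurd e.symm (aux _ _)
  · have e' := congrArg (fun z => zᶜ) e
    simp only [MVAlgebra.compl_compl'] at e'
    rw [hi (Subtype.ext e')]

end PMV

theorem mainTheorem3 :
    Phi.{u}.IsEquivalence ∧
    ∀ (X Y : PMV.{u}) (h : Phi.obj X ⟶ Phi.obj Y),
      ∃ φ : X ⟶ Y, Phi.map φ = h ∧ (∀ ψ : X ⟶ Y, Phi.map ψ = h → ψ = φ) ∧
        (Function.Surjective (EMVHom.toFun h) → Function.Surjective (PMV.Hom.toMVHom φ).toFun) ∧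
        (Function.Injective (EMVHom.toFun h) → Function.Injective (PMV.Hom.toMVHom φ).toFun) := by
  refine ⟨?_, fun X Y h => ?_⟩
  · have hfaithful : Phi.{u}.Faithful := ⟨fun {_ _} _ _ e => PMV.Hom.restrict_injective e⟩
    have hfull : Phi.{u}.Full := ⟨fun {_ _} h => ⟨PMV.extend h, PMV.restrict_extend h⟩⟩
    have hess : Phi.{u}.EssSurj := ⟨fun X => ⟨X.toPMV, ⟨X.iso⟩⟩⟩
    exact {}
  · exact ⟨PMV.extend h, PMV.restrict_extend h,
      fun ψ hψ => PMV.Hom.restrict_injective (hψ.trans (PMV.restrict_extend h).symm),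
      PMV.extendFun_surjective, PMV.extendFun_injective⟩
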